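/- Let $J,G,P,D\in\mathbb N$. Fix a grouping of $J$ joints into $G$ (possibly overlapping) groups of $P$ joints, given by a map $\iota:[G]\times[P]\to[J]$, together with weights $w_{i,p}\in\mathbb R$ such that $\sum_{(i,p):\,\iota(i,p)=j}w_{i,p}=1$ for every joint $j$ (so every joint lies in some group). For every feature dimension $D'$ the tokenizer $HT:\mathbb R^{J\times D'}\to\mathbb R^{G\times (P\times D')}$ is $HT(\mathbf x)_{i}=(\mathbf x_{\iota(i,1)},\dots,\mathbf x_{\iota(i,P)})$ and the inverse tokenizer is $HT^{-1}(\mathbf y)_j=\sum_{(i,p):\,\iota(i,p)=j}w_{i,p}\,\mathbf y_{i,p}$, so that $HT^{-1}(HT(\mathbf x))=\mathbf x$. For $\sigma\in \mathrm{Sym}(J)$ let $(\mathbf x^\sigma)_j=\mathbf x_{\sigma(j)}$, and let $H=\{\sigma\in \mathrm{Sym}(J): HT(\mathbf x^\sigma)=HT(\mathbf x)\ \text{for all } \mathbf x\in\mathbb R^{J\times D}\}$, a subgroup of $\mathrm{Sym}(J)$. An SSD module is a Mamba-2 block. It maps sequences $(u_t)_{1\le t\le L}$ in $\mathbb R^E$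 to sequences in $\mathbb R^E$. Affine projections of $u_t$ give a gate $z_t$ and raw channels $(x_t,B_t,C_t)$; the latter pass through a causal depthwise convolution (zero padding, with bias) and the activation $\mathrm{SiLU}(v)=v/(1+e^{-v})$. Here $x_t,z_t$ have heads $x_t^h,z_t^h$ and $B_t,C_t\in\mathbb R^N$ are shared by the heads. With $\Delta^h_t=\log(1+e^{v})$ for an affine function $v$ of $u_t$, and with $a_h<0$, $d_h\in\mathbb R$, each channel of head $h$ satisfies $s_t=e^{a_h\Delta^h_t}s_{t-1}+\Delta^h_t x^h_t B_t$, $s_0=0$, $y^h_t=\langle C_t,s_t\rangle+d_hx^h_t$. The output is an affine projection to $\mathbb R^E$ of $\mathrm{RMSNorm}(y_t\odot \mathrm{SiLU}(z_t))$, where $\mathrm{RMSNorm}(v)_c=\gamma_c v_c/\sqrt{\mathrm{mean}(v^2)+e}$, $e>0$. All inner sizes and weights are free. A Skeleton Mamba block with feature dimension $D'$ maps $\mathbf x\in\mathbb R^{T\times J\times D'}$ to $\mathbb R^{T\times J\times D'}$ as follows. In each frame: (1) tokenize, $\mathbf g=HT(\mathbf x)$; (2) group scan: for some $n\ge1$ and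 $\pi_1,\dots,\pi_n\in\mathrm{Sym}(G)$, concatenate the sequences $(\mathbf g_{\pi_k(1)},\dots,\mathbf g_{\pi_k(G)})$, $k=1,\dots,n$, apply one SSD module to the resulting sequence of $nG$ tokens, split the output into $n$ segments, undo $\pi_k$ on the $k$-th segment and average over $k$; (3) joint scan: apply to each group token one affine map of $\mathbb R^{P\times D'}$, read the result as a sequence of $P$ tokens in $\mathbb R^{D'}$, and apply an SSD module, the weights being shared by all groups; (4) apply $HT^{-1}$. Finally (5) temporal scan: along the time axis of each joint, add the outputs of a forward and of a backward SSD module (weights shared by all joints). A Skeleton Mamba network on $\mathbb R^{J\times D}$ is a Skeleton Mamba block of some feature dimension $D'$ acting on one frame ($T=1$), preceded by an affine map $\mathbb R^D\to\mathbb R^{D'}$ and followed by an affine map $\mathbb R^{D'}\to\mathbb R^{D}$, each applied to every joint. Theorem. For every continuous $g:\mathbb R^{J\times D}\to\mathbb R^{J\times D}$ that is $H$-equivariant, i.e. $g(\mathbf x^\sigma)=g(\mathbf x)^\sigma$ for all $\sigma\in H$ and all $\mathbf x$, every compact $K\subseteq\mathbb R^{J\times D}$ and every $\epsilon>0$, there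 is a Skeleton Mamba network computing a function $f:\mathbb R^{J\times D}\to\mathbb R^{J\times D}$ (with the given $HT$, $HT^{-1}$) such that $\|f(\mathbf x)-g(\mathbf x)\|_\infty<\epsilon$ for all $\mathbf x\in K$. -/

import Mathlib

namespace SkeletonMamba

/-! ### The state space duality (SSD) module -/

/-- The SiLU activation `v * sigmoid v`. -/
noncomputable def silu (v : ℝ) : ℝ := v / (1 + Real.exp (-v))

/-- The softplus function. -/
noncomputable def softplus (v : ℝ) : ℝ := Real.log (1 + Real.exp v)

/-- Causal depthwise convolution along a sequence of length `L`, with zero padding on the left: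
channel `c` at time `t` is `b c + ∑ j, w c j * v (t - j) c`. -/
noncomputable def causalConv {κ : Type} {L k : ℕ} (w : κ → Fin k → ℝ) (b : κ → ℝ)
    (v : Fin L → κ → ℝ) : Fin L → κ → ℝ := fun t c =>
  b c + ∑ j : Fin k, if (j : ℕ) ≤ (t : ℕ) then
    w c j * v ⟨(t : ℕ) - (j : ℕ), lt_of_le_of_lt (Nat.sub_le _ _) t.isLt⟩ c else 0

/-- The scalar-identity selective state space model of one head, in its dual (masked, quadratic)
form. It is the solution `y t = C t ⬝ h t` of the recurrence
`h t = exp (a * Δ t) • h (t - 1) + Δ t • x t • B t`, started from the zero state. -/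
noncomputable def selectiveScan {L N : ℕ} (a : ℝ) (Δ : Fin L → ℝ) (B C : Fin L → Fin N → ℝ)
    (x : Fin L → ℝ) : Fin L → ℝ := fun t =>
  ∑ s ∈ Finset.Iic t,
    (∏ r ∈ Finset.Ioc s t, Real.exp (a * Δ r)) * (C t ⬝ᵥ B s) * (Δ s * x s)

/-- Root mean square normalization with gain `γ` and stabilizer `e`. -/
noncomputable def rmsNorm {κ : Type} [Fintype κ] (γ : κ → ℝ) (e : ℝ) (v : κ → ℝ) : κ → ℝ :=
  fun c => γ c * (v c / Real.sqrt ((∑ c', v c' ^ 2) / (Fintype.card κ : ℝ) + e))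

/-- Inner channels of an SSD module: `heads` heads of dimension `headDim`. -/
abbrev Inner (heads headDim : ℕ) : Type := Fin heads × Fin headDim

/-- Hyperparameters and weights of an SSD module (Mamba-2 block) on tokens with features indexed
by `ι`. The channels that pass through the convolution are the values `x`, then the input vectors
`B`, then the output vectors `C`; `B` and `C` are shared by all heads. -/
structure SSD (ι : Type) where
  heads : ℕ
  headDim : ℕ
  stateDim : ℕ
  kernel : ℕ
  /-- input projection to the gate -/
  gateW : Matrix (Inner heads headDim) ι ℝ
  gateBias : Inner heads headDim → ℝ
  /-- input projection to `(x, B, C)` -/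
  inW : Matrix (Inner heads headDim ⊕ Fin stateDim ⊕ Fin stateDim) ι ℝ
  inBias : Inner heads headDim ⊕ Fin stateDim ⊕ Fin stateDim → ℝ
  /-- depthwise convolution of `(x, B, C)` -/
  convW : Inner heads headDim ⊕ Fin stateDim ⊕ Fin stateDim → Fin kernel → ℝ
  convBias : Inner heads headDim ⊕ Fin stateDim ⊕ Fin stateDim → ℝ
  /-- input projection to the step sizes, one per head -/
  stepW : Matrix (Fin heads) ι ℝ
  stepBias : Fin heads → ℝ
  /-- the decay rate of head `h` is `-exp (logDecay h)` -/
  logDecay : Fin heads → ℝ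
  /-- skip connection, one scalar per head -/
  skip : Fin heads → ℝ
  normGain : Inner heads headDim → ℝ
  normEps : ℝ
  normEps_pos : 0 < normEps
  /-- output projection -/
  outW : Matrix ι (Inner heads headDim) ℝ
  outBias : ι → ℝ

namespace SSD

variable {ι : Type} [Fintype ι] {L : ℕ}

/-- The convolved and activated channels `(x, B, C)`. -/
noncomputable def xBC (m : SSD ι) (u : Fin L → ι → ℝ) :
    Fin L → Inner m.heads m.headDim ⊕ Fin m.stateDim ⊕ Fin m.stateDim → ℝ := fun t c =>
  silu (causalConv m.convW m.convBias (fun s => m.inW.mulVec (u s) + m.inBias) t c)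

/-- The step sizes. -/
noncomputable def step (m : SSD ι) (u : Fin L → ι → ℝ) : Fin L → Fin m.heads → ℝ := fun t h =>
  softplus ((m.stepW.mulVec (u t) + m.stepBias) h)

/-- Output of the state space model with skip connection. -/
noncomputable def scan (m : SSD ι) (u : Fin L → ι → ℝ) :
    Fin L → Inner m.heads m.headDim → ℝ := fun t c =>
  selectiveScan (-Real.exp (m.logDecay c.1)) (fun s => m.step u s c.1)
      (fun s n => m.xBC u s (Sum.inr (Sum.inl n))) (fun s n => m.xBC u s (Sum.inr (Sum.inr n)))
      (fun s => m.xBC u s (Sum.inl c)) t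
    + m.skip c.1 * m.xBC u t (Sum.inl c)

/-- The sequence map computed by an SSD module. -/
noncomputable def apply (m : SSD ι) (u : Fin L → ι → ℝ) : Fin L → ι → ℝ := fun t =>
  m.outW.mulVec (rmsNorm m.normGain m.normEps
    (fun c => m.scan u t c * silu ((m.gateW.mulVec (u t) + m.gateBias) c))) + m.outBias

end SSD

/-! ### Poses and tokenizers -/

/-- Poses with `J` joints and `D` features per joint. -/
abbrev Pose (J D : ℕ) : Type := Fin J → Fin D → ℝ

/-- The pose `x^σ`, whose joint `j` is joint `σ j` of `x`. -/
def permute {J D : ℕ} (σ : Equiv.Perm (Fin J)) (x : Pose J D) : Pose J D := fun j => x (σ j)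

/-- A grouping of `J` joints into `G` possibly overlapping groups of `P` joints, with the weights
by which the copies of a joint are merged again. The weights of the copies of each joint sum to
`1` (for example: the mean of all copies, or the choice of one copy); in particular each joint
lies in at least one group. -/
structure Tokenizer (J G P : ℕ) where
  joint : Fin G → Fin P → Fin J
  weight : Fin G → Fin P → ℝ
  sum_weight : ∀ j, ∑ i, ∑ p, (if joint i p = j then weight i p else 0) = 1

namespace Tokenizer

variable {J G P : ℕ}

/-- HumanTokenizer: token `i` is the concatenation of the joints of group `i`. -/
def tokenize (τ : Tokenizer J G P) {D : ℕ} (x : Pose J D) : Fin G → Fin P × Fin D → ℝ :=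
  fun i e => x (τ.joint i e.1) e.2

/-- InverseHumanTokenizer: merges the copies of each joint. -/
def untokenize (τ : Tokenizer J G P) {D : ℕ} (y : Fin G → Fin P → Fin D → ℝ) : Pose J D :=
  fun j d => ∑ i, ∑ p, if τ.joint i p = j then τ.weight i p * y i p d else 0

theorem untokenize_tokenize (τ : Tokenizer J G P) {D : ℕ} (x : Pose J D) :
    τ.untokenize (fun i p d => τ.tokenize x i (p, d)) = x := by
  funext j d
  have h : ∀ i p, (if τ.joint i p = j then τ.weight i p * x (τ.joint i p) d else 0)
      = (if τ.joint i p = j then τ.weight i p else 0) * x j d := by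
    intro i p
    split_ifs with hj
    · rw [hj]
    · rw [zero_mul]
  simp only [untokenize, tokenize, h, ← Finset.sum_mul]
  rw [τ.sum_weight j, one_mul]

/-- The group `H` of joint permutations that leave the tokenizer unchanged on `Pose J D`. -/
def symmetries (τ : Tokenizer J G P) (D : ℕ) : Subgroup (Equiv.Perm (Fin J)) where
  carrier := {σ | ∀ x : Pose J D, τ.tokenize (permute σ x) = τ.tokenize x}
  one_mem' := fun _ => rfl
  mul_mem' := fun {σ ρ} hσ hρ x => (hρ (permute σ x)).trans (hσ x)
  inv_mem' := fun {σ} hσ x => by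
    have h := hσ (permute σ⁻¹ x)
    have e : permute σ (permute σ⁻¹ x) = x := by
      funext j
      simp [permute]
    rw [e] at h
    exact h.symm

end Tokenizer

/-- `g` commutes with the joint permutations in `H`. -/
def Equivariant {J D : ℕ} (H : Subgroup (Equiv.Perm (Fin J))) (g : Pose J D → Pose J D) : Prop :=
  ∀ σ ∈ H, ∀ x, g (permute σ x) = permute σ (g x)

/-! ### The Skeleton Mamba block -/

/-- Multi-directional SSD: the `n` reorderings of the `G` tokens are concatenated to a sequence of
length `n * G` (reordering `k` occupies the `k`-th segment of length `G`), processed by one SSD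
module, split, put back in the original order, and averaged. -/
noncomputable def groupScan {ι : Type} [Fintype ι] {G n : ℕ} (m : SSD ι)
    (π : Fin n → Equiv.Perm (Fin G)) (g : Fin G → ι → ℝ) : Fin G → ι → ℝ := fun i e =>
  (∑ k, m.apply
      (fun s : Fin (n * G) => g (π (finProdFinEquiv.symm s).1 (finProdFinEquiv.symm s).2))
      (finProdFinEquiv (k, (π k)⁻¹ i)) e) / (n : ℝ)

/-- Joint scan: every group token goes through the same linear layer, is rearranged to a sequence
of `P` joints, and is processed by an SSD module with weights shared by all groups. -/
noncomputable def jointScan {G P D : ℕ} (W : Matrix (Fin P × Fin D) (Fin P × Fin D) ℝ)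
    (b : Fin P × Fin D → ℝ) (m : SSD (Fin D)) (y : Fin G → Fin P × Fin D → ℝ) :
    Fin G → Fin P → Fin D → ℝ := fun i =>
  m.apply fun p d => (W.mulVec (y i) + b) (p, d)

/-- Temporal scan: each joint trajectory is scanned forward and backward in time by two SSD
modules, and the two outputs are added. -/
noncomputable def temporalScan {T J D : ℕ} (fwd bwd : SSD (Fin D)) (t : Fin T → Pose J D) :
    Fin T → Pose J D := fun s j d =>
  fwd.apply (fun r => t r j) s d + bwd.apply (fun r => t (Fin.rev r) j) (Fin.rev s) d

/-- Hyperparameters and weights of a Skeleton Mamba block, for `G` groups of `P` joints with `D`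
features per joint. -/
structure Block (G P D : ℕ) where
  directions : ℕ
  directions_pos : 0 < directions
  perm : Fin directions → Equiv.Perm (Fin G)
  groupSSD : SSD (Fin P × Fin D)
  linW : Matrix (Fin P × Fin D) (Fin P × Fin D) ℝ
  linBias : Fin P × Fin D → ℝ
  jointSSD : SSD (Fin D)
  fwdSSD : SSD (Fin D)
  bwdSSD : SSD (Fin D)

/-- The map on motions of `T` frames computed by a Skeleton Mamba block: tokenizer, group scan and
joint scan in each frame, inverse tokenizer, then temporal scan. -/
noncomputable def Block.apply {J G P D T : ℕ} (β : Block G P D) (τ : Tokenizer J G P)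
    (x : Fin T → Pose J D) : Fin T → Pose J D :=
  temporalScan β.fwdSSD β.bwdSSD fun s =>
    τ.untokenize
      (jointScan β.linW β.linBias β.jointSSD
        (groupScan β.groupSSD β.perm (τ.tokenize (x s))))

/-- A Skeleton Mamba network on poses with `D` features per joint: a Skeleton Mamba block of some
feature dimension `width`, between linear layers that act on each joint separately and are shared
by all joints. -/
structure Network (G P D : ℕ) where
  width : ℕ
  embedW : Matrix (Fin width) (Fin D) ℝ
  embedBias : Fin width → ℝ
  block : Block G P width
  readW : Matrix (Fin D) (Fin width) ℝ
  readBias : Fin D → ℝ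

/-- The function on single poses (motions of one frame) computed by a network. -/
noncomputable def Network.toFun {J G P D : ℕ} (f : Network G P D) (τ : Tokenizer J G P)
    (x : Pose J D) : Pose J D := fun j =>
  f.readW.mulVec
    (f.block.apply τ (fun _ : Fin 1 => fun j' => f.embedW.mulVec (x j') + f.embedBias) 0 j)
    + f.readBias

end SkeletonMamba

namespace SkeletonMamba

/-! Every joint lies in a group, so for `D > 0` the group `H` is trivial and arbitrary continuous
maps have to be approximated. It suffices that one scan gathers the whole pose without loss and that
another applies an arbitrary continuous function to each token. Neither task needs the state space
part: with state dimension zero, skip weight one and a constant gate, an SSD module is an affine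
map, a convolution, SiLU, RMSNorm and an affine map (`SSD.ofConv_apply`). Gathering: the group scan
reads two copies of the tokens in the original order, with a kernel of length `2 * G`. In the second
copy every token has all groups in its past, so the delays expose the whole pose. Averaging with the
first copy, SiLU and the normalization do not destroy this: group index and pose can be recovered
from the feature (`delayFeature_injective`). Computing: a bias adds the index of the joint within
its group. Each joint token is then a continuous injective function of (group, slot, pose). On a
compact set this is a closed embedding, so by Tietze the desired value at that joint is a continuous
function of the token. The joint scan approximates this function by `SSD.exists_approx`, where
RMSNorm is almost the identity and SiLU units imitate exponentials. The temporal scan only has to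
approximate the identity. -/

/-! ### SiLU, and SSD modules reduced to a convolution -/

theorem silu_zero : silu 0 = 0 := by simp [silu]

theorem silu_one_pos : 0 < silu 1 := by unfold silu; positivity

/-- SiLU is not injective; this recovers a coordinate from its two signed channels. -/
theorem silu_sub_silu_neg (v : ℝ) : silu v - silu (-v) = v := by
  have h : Real.exp (-v) * Real.exp v = 1 := by rw [← Real.exp_add]; simp
  have h1 : 1 + Real.exp (-v) ≠ 0 := by positivity
  have h2 : 1 + Real.exp v ≠ 0 := by positivity
  unfold silu
  rw [neg_neg, div_sub_div _ _ h1 h2, div_eq_iff (mul_ne_zero h1 h2)]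
  linear_combination (-v) * h

theorem continuous_silu : Continuous silu := by
  unfold silu
  exact continuous_id.div (by fun_prop) fun v => by positivity

/-- The module without state space part and with constant gate: a causal convolution with
activation, followed by the normalization. -/
noncomputable def SSD.ofConv {ι κ : Type} [Fintype κ] {k : ℕ} (A : Matrix κ ι ℝ) (b : κ → ℝ)
    (w : κ → Fin k → ℝ) (b' : κ → ℝ) (γ e : ℝ) (he : 0 < e) (W : Matrix ι κ ℝ) (c : ι → ℝ) :
    SSD ι where
  heads := 1
  headDim := Fintype.card κ
  stateDim := 0
  kernel := k
  gateW := 0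
  gateBias := 1
  inW := Sum.elim (fun q => A ((Fintype.equivFin κ).symm q.2)) 0
  inBias := Sum.elim (fun q => b ((Fintype.equivFin κ).symm q.2)) 0
  convW := Sum.elim (fun q => w ((Fintype.equivFin κ).symm q.2)) 0
  convBias := Sum.elim (fun q => b' ((Fintype.equivFin κ).symm q.2)) 0
  stepW := 0
  stepBias := 0
  logDecay := 0
  skip := 1
  normGain := fun _ => γ
  normEps := e
  normEps_pos := he
  outW := fun i q => W i ((Fintype.equivFin κ).symm q.2)
  outBias := c

theorem SSD.ofConv_apply {ι κ : Type} [Fintype ι] [Fintype κ] {k L : ℕ} (A : Matrix κ ι ℝ)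
    (b : κ → ℝ) (w : κ → Fin k → ℝ) (b' : κ → ℝ) (γ e : ℝ) (he : 0 < e) (W : Matrix ι κ ℝ)
    (c : ι → ℝ) (u : Fin L → ι → ℝ) (t : Fin L) (i : ι) :
    (SSD.ofConv A b w b' γ e he W c).apply u t i =
      ∑ q, W i q * rmsNorm (fun _ => γ) e (fun q =>
        silu (causalConv w b' (fun s => A.mulVec (u s) + b) t q) * silu 1) q + c i := by
  set φ : Fin 1 × Fin (Fintype.card κ) ≃ κ :=
    (Equiv.uniqueProd _ (Fin 1)).trans (Fintype.equivFin κ).symm with hφ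
  have hs : ∀ q : Fin 1 × Fin (Fintype.card κ),
      (SSD.ofConv A b w b' γ e he W c).scan u t q *
        silu (((SSD.ofConv A b w b' γ e he W c).gateW.mulVec (u t) +
          (SSD.ofConv A b w b' γ e he W c).gateBias) q) =
      silu (causalConv w b' (fun s => A.mulVec (u s) + b) t (φ q)) * silu 1 := by
    intro q
    have h1 : ((SSD.ofConv A b w b' γ e he W c).gateW.mulVec (u t) +
          (SSD.ofConv A b w b' γ e he W c).gateBias) q = 1 := by
      have h0 : (SSD.ofConv A b w b' γ e he W c).gateW.mulVec (u t) q = 0 :=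
        Finset.sum_eq_zero fun j _ => zero_mul _
      exact (congrArg (· + (1 : ℝ)) h0).trans (zero_add 1)
    rw [h1]
    congr 1
    have h2 : ∀ x y : Fin (SSD.ofConv A b w b' γ e he W c).stateDim → ℝ, x ⬝ᵥ y = 0 :=
      fun x y => Finset.sum_eq_zero fun n _ => Fin.elim0 n
    simp only [SSD.scan, selectiveScan, h2, mul_zero, zero_mul, Finset.sum_const_zero, zero_add]
    show (1 : ℝ) * _ = _
    rw [one_mul]
    rfl
  have hr : ∀ q : Fin 1 × Fin (Fintype.card κ),
      rmsNorm (fun _ => γ) e (fun q : Fin 1 × Fin (Fintype.card κ) =>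
        silu (causalConv w b' (fun s => A.mulVec (u s) + b) t (φ q)) * silu 1) q =
      rmsNorm (fun _ => γ) e (fun q =>
        silu (causalConv w b' (fun s => A.mulVec (u s) + b) t q) * silu 1) (φ q) := by
    intro q
    unfold rmsNorm
    rw [φ.sum_comp (fun q =>
        (silu (causalConv w b' (fun s => A.mulVec (u s) + b) t q) * silu 1) ^ 2),
      Fintype.card_congr φ]
  rw [← φ.sum_comp]
  simp_rw [← hr]
  exact congrArg (fun v => ((SSD.ofConv A b w b' γ e he W c).outW.mulVec
    (rmsNorm (fun _ => γ) e v) + (SSD.ofConv A b w b' γ e he W c).outBias) i) (funext hs)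

/-! ### Approximation of continuous maps token by token -/

/-- Stone–Weierstrass: products of exponentials of linear forms are again such exponentials, so
their span is an algebra. It is obtained as the range of the monoid algebra of `ι → ℝ`, and the
coordinate exponentials separate points. -/
theorem exists_expSum_approx {ι : Type} [Fintype ι] (K : Set (ι → ℝ)) (hK : IsCompact K)
    (f : (ι → ℝ) → ℝ) (hf : Continuous f) (ε : ℝ) (hε : 0 < ε) :
    ∃ p : (ι → ℝ) →₀ ℝ, ∀ u ∈ K, |(p.sum fun a r => r * Real.exp (a ⬝ᵥ u)) - f u| < ε := by
  let E : Multiplicative (ι → ℝ) →* C(ι → ℝ, ℝ) :=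
    { toFun := fun a => ⟨fun u => Real.exp (a.toAdd ⬝ᵥ u), by
        unfold dotProduct
        exact Real.continuous_exp.comp (continuous_finsetSum _ fun i _ =>
          continuous_const.mul (continuous_apply i))⟩
      map_one' := by ext u; simp
      map_mul' := fun a b => by ext u; simp [add_dotProduct, Real.exp_add] }
  let Φ := AddMonoidAlgebra.lift ℝ C(ι → ℝ, ℝ) (ι → ℝ) E
  have hsep : Φ.range.SeparatesPoints := by
    intro u v huv
    obtain ⟨i, hi⟩ := Function.ne_iff.mp huv
    classical
    refine ⟨_, ⟨_, ⟨AddMonoidAlgebra.single (Pi.single i 1) 1, rfl⟩, rfl⟩, ?_⟩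
    simpa [Φ, E, AddMonoidAlgebra.lift_single] using hi
  obtain ⟨_, ⟨p, rfl⟩, hp⟩ :=
    ContinuousMap.exists_mem_subalgebra_near_continuous_of_isCompact_of_separatesPoints
      hsep ⟨f, hf⟩ hK hε
  refine ⟨p.coeff, fun u hu => ?_⟩
  convert hp u hu using 3
  simp [Φ, AddMonoidAlgebra.lift_apply, Finsupp.sum, E]

/-- Far to the left `silu w` behaves like `w * exp w`. After rescaling, `silu (v - M)` becomes `exp
v * (1 - v / M) / (1 + exp (v - M))`, which tends to `exp v` uniformly on bounded sets. -/
theorem exists_silu_approx_exp (R ε : ℝ) (hε : 0 < ε) :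
    ∃ M : ℝ, ∀ v, |v| ≤ R → |(-Real.exp M / M) * silu (v - M) - Real.exp v| < ε := by
  have hlim : Filter.Tendsto (fun M : ℝ => Real.exp R * (Real.exp (R - M) + R / M)) Filter.atTop
      (nhds (Real.exp R * (0 + 0))) := by
    refine Filter.Tendsto.const_mul _ (Filter.Tendsto.add ?_ ?_)
    · exact Real.tendsto_exp_atBot.comp
        (Filter.tendsto_atBot_add_const_left _ R Filter.tendsto_neg_atTop_atBot)
    · exact tendsto_const_nhds.div_atTop Filter.tendsto_id
  rw [add_zero, mul_zero] at hlim
  obtain ⟨M, hM, hM0⟩ := ((hlim.eventually_lt_const hε).and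
    (Filter.eventually_gt_atTop (0 : ℝ))).exists
  refine ⟨M, fun v hv => lt_of_le_of_lt ?_ hM⟩
  have hv' := abs_le.mp hv
  have hq : 0 < 1 + Real.exp (v - M) := by positivity
  have key : (-Real.exp M / M) * silu (v - M) - Real.exp v =
      -(Real.exp v * ((Real.exp (v - M) + v / M) / (1 + Real.exp (v - M)))) := by
    have h1 : Real.exp (-(v - M)) = (Real.exp (v - M))⁻¹ := Real.exp_neg _
    have h2 : Real.exp v = Real.exp M * Real.exp (v - M) := by rw [← Real.exp_add]; ring_nf
    unfold silu
    rw [h1, h2]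
    have : 0 < Real.exp (v - M) := Real.exp_pos _
    field_simp
    ring
  rw [key, abs_neg, abs_mul, abs_of_pos (Real.exp_pos v), abs_div, abs_of_pos hq]
  refine mul_le_mul (Real.exp_le_exp.mpr hv'.2) ?_ (by positivity) (by positivity)
  refine (div_le_self (abs_nonneg _) (by linarith [Real.exp_pos (v - M)])).trans ?_
  refine (abs_add_le _ _).trans (add_le_add ?_ ?_)
  · rw [abs_of_pos (Real.exp_pos _)]
    exact Real.exp_le_exp.mpr (by linarith)
  · rw [abs_div, abs_of_pos hM0]
    gcongr

/-- A stabilizer `M ^ 2` much larger than the mean square makes the denominator almost the constant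
`M`, and the gain `M / s` cancels it together with the factor `s` left by the constant gate. -/
theorem exists_rmsNorm_approx_id {κ : Type} [Fintype κ] (s R ε : ℝ) (hs : 0 < s) (hR : 0 < R)
    (hε : 0 < ε) : ∃ γ e : ℝ, 0 < e ∧ ∀ v : κ → ℝ, (∀ q, |v q| ≤ R) →
      ∀ q, |rmsNorm (fun _ => γ) e (fun q => v q * s) q - v q| < ε := by
  obtain ⟨M, hM, hM0⟩ : ∃ M : ℝ, R * (R * s) ^ 2 / ε < M ^ 2 ∧ 0 < M := by
    have := (Filter.tendsto_pow_atTop (α := ℝ) two_ne_zero).eventually_gt_atTop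
      (R * (R * s) ^ 2 / ε)
    exact (this.and (Filter.eventually_gt_atTop 0)).exists
  refine ⟨M / s, M ^ 2, by positivity, fun v hv q => ?_⟩
  have : Nonempty κ := ⟨q⟩
  set m := (∑ c', (v c' * s) ^ 2) / (Fintype.card κ : ℝ) with hm
  have hm0 : 0 ≤ m := by positivity
  have hmR : m ≤ (R * s) ^ 2 := by
    rw [hm, div_le_iff₀ (by exact_mod_cast Fintype.card_pos)]
    calc ∑ c', (v c' * s) ^ 2 ≤ ∑ _c' : κ, (R * s) ^ 2 := by
          refine Finset.sum_le_sum fun c' _ => ?_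
          rw [mul_pow, mul_pow]
          gcongr ?_ * _
          exact sq_le_sq' (abs_le.mp (hv c')).1 (abs_le.mp (hv c')).2
      _ = _ := by simp [mul_comm]
  set ρ := Real.sqrt (m + M ^ 2) with hρ
  have hρ2 : ρ ^ 2 = m + M ^ 2 := Real.sq_sqrt (by positivity)
  have hρM : M ≤ ρ := Real.le_sqrt_of_sq_le (by linarith)
  have hρ0 : 0 < ρ := hM0.trans_le hρM
  have key : rmsNorm (fun _ => M / s) (M ^ 2) (fun q => v q * s) q - v q =
      -(v q * ((ρ - M) / ρ)) := by
    unfold rmsNorm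
    rw [← hm, ← hρ]
    field_simp
    ring
  have hle : (ρ - M) / ρ ≤ (R * s) ^ 2 / M ^ 2 := by
    rw [div_le_div_iff₀ hρ0 (by positivity)]
    -- The difference of squares bounds the relative error of the denominator by `m / M ^ 2`.
    have h3 : (ρ - M) * (ρ + M) = m := by linear_combination hρ2
    have h4 : (ρ - M) * M ≤ m := by
      rw [← h3]; exact mul_le_mul_of_nonneg_left (by linarith) (by linarith)
    calc (ρ - M) * M ^ 2 = ((ρ - M) * M) * M := by ring
      _ ≤ (R * s) ^ 2 * ρ := mul_le_mul (h4.trans hmR) hρM hM0.le (by positivity)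
  rw [key, abs_neg, abs_mul, abs_of_nonneg (div_nonneg (by linarith) hρ0.le)]
  calc |v q| * ((ρ - M) / ρ) ≤ R * ((R * s) ^ 2 / M ^ 2) :=
        mul_le_mul (hv q) hle (div_nonneg (by linarith) hρ0.le) hR.le
    _ < ε := by
        rw [← mul_div_assoc, div_lt_iff₀ (by positivity)]
        rwa [div_lt_iff₀ hε, mul_comm (M ^ 2)] at hM

theorem causalConv_one {κ : Type} {L : ℕ} (b : κ → ℝ) (v : Fin L → κ → ℝ) (t : Fin L) (q : κ) :
    causalConv (fun _ (_ : Fin 1) => 1) b v t q = b q + v t q := by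
  simp [causalConv]

/-- SSD modules approximate every continuous map that acts on each token separately. -/
theorem SSD.exists_approx {ι : Type} [Fintype ι] (K : Set (ι → ℝ)) (hK : IsCompact K)
    (F : (ι → ℝ) → ι → ℝ) (hF : Continuous F) (ε : ℝ) (hε : 0 < ε) :
    ∃ m : SSD ι, ∀ {L : ℕ} (u : Fin L → ι → ℝ) (t : Fin L), u t ∈ K →
      ∀ i, |m.apply u t i - F (u t) i| < ε := by
  classical
  choose p hp using fun i => exists_expSum_approx K hK (fun u => F u i)
    ((continuous_apply i).comp hF) (ε / 3) (by positivity)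
  set S : Finset (ι → ℝ) := Finset.univ.biUnion fun i => (p i).support with hS
  have hsum : ∀ i u, ((p i).sum fun a r => r * Real.exp (a ⬝ᵥ u)) =
      ∑ a : S, p i a * Real.exp (a.1 ⬝ᵥ u) := by
    intro i u
    rw [Finset.sum_coe_sort S fun a => p i a * Real.exp (a ⬝ᵥ u)]
    refine Finset.sum_subset (Finset.subset_biUnion_of_mem (fun i => (p i).support)
      (Finset.mem_univ i)) fun a _ ha => ?_
    simp [Finsupp.notMem_support_iff.mp ha]
  -- a common bound for the exponents and for the coefficients
  have hbd : ∃ R, ∀ a : S, ∀ u ∈ K, |a.1 ⬝ᵥ u| ≤ R := by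
    have h1 : ∀ a : S, ∃ R, ∀ u ∈ K, |a.1 ⬝ᵥ u| ≤ R := fun a =>
      hK.exists_bound_of_continuousOn (f := fun u => a.1 ⬝ᵥ u) (by
        unfold dotProduct
        exact (continuous_finsetSum _ fun i _ =>
          continuous_const.mul (continuous_apply i)).continuousOn)
    choose R hR using h1
    refine ⟨∑ a, |R a|, fun a u hu => (hR a u hu).trans ((le_abs_self _).trans ?_)⟩
    exact Finset.single_le_sum (f := fun a => |R a|) (fun _ _ => abs_nonneg _) (Finset.mem_univ a)
  obtain ⟨R, hR⟩ := hbd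
  have hcoef : ∀ (c : ι → S → ℝ), ∃ Q, 0 < Q ∧ ∀ i, ∑ a, |c i a| ≤ Q := by
    intro c
    refine ⟨∑ i, ∑ a, |c i a| + 1, by positivity, fun i => ?_⟩
    have := Finset.single_le_sum (f := fun i => ∑ a, |c i a|)
      (fun _ _ => Finset.sum_nonneg fun _ _ => abs_nonneg _) (Finset.mem_univ i)
    linarith
  have hsub : ∀ (c : S → ℝ) (Q δ : ℝ) (x y : S → ℝ), 0 < Q → ∑ a, |c a| ≤ Q →
      (∀ a, |x a - y a| < δ / Q) → 0 < δ → |∑ a, c a * x a - ∑ a, c a * y a| ≤ δ := by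
    intro c Q δ x y hQ hc hxy hδ
    rw [← Finset.sum_sub_distrib]
    calc |∑ a, (c a * x a - c a * y a)| ≤ ∑ a, |c a * x a - c a * y a| :=
          Finset.abs_sum_le_sum_abs _ _
      _ ≤ ∑ a, |c a| * (δ / Q) := by
          refine Finset.sum_le_sum fun a _ => ?_
          rw [← mul_sub, abs_mul]
          exact mul_le_mul_of_nonneg_left (hxy a).le (abs_nonneg _)
      _ ≤ Q * (δ / Q) := by
          rw [← Finset.sum_mul]
          exact mul_le_mul_of_nonneg_right hc (by positivity)
      _ = δ := by field_simp
  -- The order matters: the shift `M` depends on the coefficients `p`, and the accuracy of the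
  -- normalization on the output weights, which grow with `M`.
  obtain ⟨Q, hQ, hpQ⟩ := hcoef fun i a => p i a
  obtain ⟨M, hM⟩ := exists_silu_approx_exp R (ε / 3 / Q) (by positivity)
  obtain ⟨Q', hQ', hpQ'⟩ := hcoef fun i a => p i a * (-Real.exp M / M)
  obtain ⟨T, hT⟩ := (isCompact_Icc (a := -R - M) (b := R - M)).exists_bound_of_continuousOn
    continuous_silu.continuousOn
  obtain ⟨γ, e, he, hrms⟩ := exists_rmsNorm_approx_id (κ := S) (silu 1) (max T 1) (ε / 3 / Q')
    silu_one_pos (by positivity) (by positivity)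
  refine ⟨SSD.ofConv (κ := S) (Matrix.of fun a => a.1) 0 (fun _ (_ : Fin 1) => 1) (fun _ => -M) γ e he
    (Matrix.of fun i a => p i a * (-Real.exp M / M)) 0, fun u t ht i => ?_⟩
  rw [SSD.ofConv_apply]
  set v : S → ℝ := fun a => silu (a.1 ⬝ᵥ u t - M) with hv
  have hconv : (fun a : S => silu (causalConv (fun _ (_ : Fin 1) => 1) (fun _ => -M)
      (fun s => (Matrix.of fun a : S => a.1).mulVec (u s) + 0) t a) * silu 1) =
      fun a => v a * silu 1 := by
    funext a
    rw [causalConv_one, hv, add_zero, neg_add_eq_sub]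
    rfl
  rw [hconv, Pi.zero_apply, add_zero]
  simp only [Matrix.of_apply]
  have h1 := hsub _ Q' (ε / 3) _ v hQ' (hpQ' i) (hrms v fun a => by
    have := abs_le.mp (hR a _ ht)
    exact (hT _ ⟨by linarith, by linarith⟩).trans (le_max_left _ _)) (by positivity)
  have h2 := hsub (fun a => p i a) Q (ε / 3) (fun a => (-Real.exp M / M) * v a)
    (fun a => Real.exp (a.1 ⬝ᵥ u t)) hQ (hpQ i) (fun a => hM _ (hR a _ ht)) (by positivity)
  have h3 := hp i (u t) ht
  rw [hsum] at h3
  simp only [← mul_assoc] at h2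
  rw [abs_le] at h1 h2
  rw [abs_lt] at h3 ⊢
  constructor <;> linarith [h1.1, h1.2, h2.1, h2.2, h3.1, h3.2]

/-- A module with constant output zero. -/
theorem SSD.exists_apply_eq_zero (ι : Type) [Fintype ι] :
    ∃ m : SSD ι, ∀ {L : ℕ} (u : Fin L → ι → ℝ) (t : Fin L) (i : ι), m.apply u t i = 0 :=
  ⟨SSD.ofConv (κ := Fin 0) (k := 0) 0 0 0 0 1 1 one_pos 0 0, fun u t i => by
    rw [SSD.ofConv_apply]; simp⟩


/-! ### A group scan that loses no information -/

/-- Channels of the delay module: the constant one and the coordinates in `α` with both signs,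
each with all delays. -/
abbrev DelayChannel (α : Type) (G : ℕ) : Type := Option (α × Bool) × Fin (2 * G)

/-- The undelayed channel of a token, read off at the coordinates `r`. -/
def readChannel {α ι : Type} (r : α → ι) (v : ι → ℝ) : Option (α × Bool) → ℝ
  | none => 1
  | some (a, true) => v (r a)
  | some (a, false) => -v (r a)

/-- The channels of the delay module after convolution. -/
noncomputable def delayed {α ι : Type} {G L : ℕ} (r : α → ι) (u : Fin L → ι → ℝ) (t : Fin L)
    (c : DelayChannel α G) : ℝ :=
  if (c.2 : ℕ) ≤ (t : ℕ) then
    readChannel r (u ⟨(t : ℕ) - (c.2 : ℕ), lt_of_le_of_lt (Nat.sub_le _ _) t.isLt⟩) c.1 else 0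

/-- The normalized activations of the delay module. -/
noncomputable def delayActivation {α ι : Type} [Fintype α] {G L : ℕ} (r : α → ι)
    (u : Fin L → ι → ℝ) (t : Fin L) : DelayChannel α G → ℝ :=
  rmsNorm (fun _ => 1) 1 fun c => silu (delayed r u t c) * silu 1

/-- Each channel has a one-hot kernel at its own delay. The constant one is added before the
convolution, so it too is cut off by the zero padding; this makes positions visible. -/
theorem SSD.exists_delay {α ι : Type} [Fintype α] [Fintype ι] (G : ℕ) (r : α → ι)
    (W : Matrix ι (DelayChannel α G) ℝ) :
    ∃ m : SSD ι, ∀ {L : ℕ} (u : Fin L → ι → ℝ) (t : Fin L) (i : ι),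
      m.apply u t i = ∑ c, W i c * delayActivation r u t c := by
  classical
  refine ⟨SSD.ofConv (κ := DelayChannel α G) (k := 2 * G)
    (Matrix.of fun c => match c.1 with
      | none => 0
      | some (a, true) => Pi.single (r a) 1
      | some (a, false) => Pi.single (r a) (-1))
    (fun c => match c.1 with
      | none => 1
      | some _ => 0)
    (fun c j => if j = c.2 then 1 else 0) 0 1 1 one_pos W 0, fun u t i => ?_⟩
  rw [SSD.ofConv_apply, Pi.zero_apply, add_zero]
  refine Finset.sum_congr rfl fun c _ => ?_
  unfold delayActivation
  congr 2
  funext c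
  congr 2
  unfold causalConv delayed
  rw [Finset.sum_eq_single c.2]
  · rw [Pi.zero_apply, zero_add]
    refine if_congr Iff.rfl ?_ rfl
    beta_reduce
    rw [if_pos rfl, one_mul, Pi.add_apply]
    rcases c with ⟨_ | ⟨a, _ | _⟩, l⟩ <;> simp [readChannel, Matrix.mulVec]
  · intro j _ hj
    simp [hj]
  · simp

/-- The two concatenated copies of the group tokens. -/
def twice {β : Type} {G : ℕ} (g : Fin G → β) : Fin (2 * G) → β :=
  fun s => g (finProdFinEquiv.symm s).2

/-- The activations of the delay module, averaged over the two copies. -/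
noncomputable def delayFeature {α ι : Type} [Fintype α] {G : ℕ} (r : α → ι) (g : Fin G → ι → ℝ)
    (i : Fin G) (c : DelayChannel α G) : ℝ :=
  (∑ k : Fin 2, delayActivation r (twice g) (finProdFinEquiv (k, i)) c) / 2

theorem exists_groupScan_eq {α ι : Type} [Fintype α] [Fintype ι] (G : ℕ) (r : α → ι)
    (W : Matrix ι (DelayChannel α G) ℝ) :
    ∃ m : SSD ι, ∀ (g : Fin G → ι → ℝ) (i : Fin G) (e : ι),
      groupScan m (fun _ : Fin 2 => 1) g i e = ∑ c, W e c * delayFeature r g i c := by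
  obtain ⟨m, hm⟩ := SSD.exists_delay G r W
  refine ⟨m, fun g i e => ?_⟩
  unfold groupScan
  simp_rw [hm]
  rw [Finset.sum_comm, Finset.sum_div]
  refine Finset.sum_congr rfl fun c _ => ?_
  rw [← Finset.mul_sum, mul_div_assoc]
  rfl

theorem continuous_delayFeature {α ι : Type} [Fintype α] {G : ℕ} (r : α → ι) (i : Fin G)
    (c : DelayChannel α G) :
    Continuous fun g : Fin G → ι → ℝ => delayFeature r g i c := by
  have h1 : ∀ (t : Fin (2 * G)) (c : DelayChannel α G),
      Continuous fun g : Fin G → ι → ℝ => silu (delayed r (twice g) t c) * silu 1 := by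
    intro t c
    refine (continuous_silu.comp ?_).mul continuous_const
    unfold delayed twice
    split_ifs
    · rcases c with ⟨_ | ⟨a, _ | _⟩, l⟩ <;> simp only [readChannel] <;> fun_prop
    · fun_prop
  unfold delayFeature delayActivation rmsNorm
  refine Continuous.div_const (continuous_finsetSum _ fun k _ => continuous_const.mul ?_) _
  refine (h1 _ c).div (Real.continuous_sqrt.comp ?_) fun g => by positivity
  exact ((continuous_finsetSum _ fun c' _ => (h1 _ c').pow 2).div_const _).add continuous_const

/-- Reading the feature with delay `l`: only the second copy contributes if `i < l`. -/
theorem exists_delayFeature_eq {α ι : Type} [Fintype α] {G : ℕ} (r : α → ι) (g : Fin G → ι → ℝ)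
    (i : Fin G) : ∃ ρ : ℝ, 0 < ρ ∧
      (∀ (o : Option (α × Bool)) (l : Fin (2 * G)) (a : Fin G), (a : ℕ) + l = G + i →
        delayFeature r g i (o, l) = silu (readChannel r (g a) o) * ρ) ∧
      ∀ (o : Option (α × Bool)) (l : Fin (2 * G)), G + (i : ℕ) < l →
        delayFeature r g i (o, l) = 0 := by
  have hzero : ∀ (t : Fin (2 * G)) (o : Option (α × Bool)) (l : Fin (2 * G)), (t : ℕ) < l →
      delayActivation r (twice g) t (o, l) = 0 := by
    intro t o l h
    simp [delayActivation, rmsNorm, delayed, not_le.mpr h, silu_zero]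
  have ht0 : ((finProdFinEquiv ((0 : Fin 2), i) : Fin (2 * G)) : ℕ) = i := by
    simp [finProdFinEquiv]
  have ht1 : ((finProdFinEquiv ((1 : Fin 2), i) : Fin (2 * G)) : ℕ) = G + i := by
    simp [finProdFinEquiv, add_comm]
  -- The gate and normalization factor at the token in the second copy, halved by the average.
  refine ⟨silu 1 / Real.sqrt ((∑ c' : DelayChannel α G, (silu (delayed r (twice g)
    (finProdFinEquiv ((1 : Fin 2), i)) c') * silu 1) ^ 2) /
    (Fintype.card (DelayChannel α G) : ℝ) + 1) / 2, ?_, ?_, ?_⟩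
  · have := silu_one_pos
    positivity
  · intro o l a hal
    unfold delayFeature
    -- Since `a < G`, the delay `l = G + i - a` exceeds `i`, so in the first copy it falls into the
    -- padding.
    rw [Fin.sum_univ_two, hzero _ o l (by rw [ht0]; omega), zero_add]
    have hd : delayed r (twice g) (finProdFinEquiv ((1 : Fin 2), i)) (o, l) =
        readChannel r (g a) o := by
      unfold delayed
      rw [if_pos (by show (l : ℕ) ≤ _; rw [ht1]; omega)]
      have hs : (⟨((finProdFinEquiv ((1 : Fin 2), i) : Fin (2 * G)) : ℕ) - (l : ℕ),
          lt_of_le_of_lt (Nat.sub_le _ _) (Fin.isLt _)⟩ : Fin (2 * G)) =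
          finProdFinEquiv ((0 : Fin 2), a) := by
        ext
        show ((finProdFinEquiv ((1 : Fin 2), i) : Fin (2 * G)) : ℕ) - (l : ℕ) = _
        rw [ht1]
        simp [finProdFinEquiv]
        omega
      unfold twice
      rw [hs, Equiv.symm_apply_apply]
    unfold delayActivation rmsNorm
    beta_reduce
    rw [hd]
    ring
  · intro o l hl
    unfold delayFeature
    rw [Fin.sum_univ_two, hzero _ o l (by rw [ht0]; omega), hzero _ o l (by rw [ht1]; omega)]
    simp

/-- The constant channel is nonzero at delay `G + i` and zero beyond, which reveals `i`; its value
there reveals the unknown scale `ρ`. After division by `ρ`, the two signs of each coordinate give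
back its value. -/
theorem delayFeature_injective {α ι : Type} [Fintype α] {G : ℕ} (r : α → ι)
    {g g' : Fin G → ι → ℝ} {i i' : Fin G} (h : delayFeature r g i = delayFeature r g' i') :
    i = i' ∧ ∀ a b, g a (r b) = g' a (r b) := by
  have hG : 0 < G := i.pos
  obtain ⟨ρ, hρ, hr, hz⟩ := exists_delayFeature_eq r g i
  obtain ⟨ρ', hρ', hr', hz'⟩ := exists_delayFeature_eq r g' i'
  have hone : silu (1 : ℝ) ≠ 0 := silu_one_pos.ne'
  have hii : i = i' := by
    rcases lt_trichotomy (i : ℕ) i' with hlt | heq | hlt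
    · exfalso
      have h1 := congrFun h (none, ⟨G + i', by omega⟩)
      rw [hz _ _ (by simpa using hlt), hr' _ _ ⟨0, hG⟩ (by simp)] at h1
      exact mul_ne_zero hone hρ'.ne' h1.symm
    · exact Fin.ext heq
    · exfalso
      have h1 := congrFun h (none, ⟨G + i, by omega⟩)
      rw [hz' _ _ (by simpa using hlt), hr _ _ ⟨0, hG⟩ (by simp)] at h1
      exact mul_ne_zero hone hρ.ne' h1
  subst hii
  have hρρ : ρ = ρ' := by
    have h1 := congrFun h (none, ⟨G + i, by omega⟩)
    rw [hr _ _ ⟨0, hG⟩ (by simp), hr' _ _ ⟨0, hG⟩ (by simp)] at h1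
    exact mul_left_cancel₀ hone h1
  subst hρρ
  refine ⟨rfl, fun a b => ?_⟩
  have hs : ∀ s, silu (readChannel r (g a) (some (b, s))) =
      silu (readChannel r (g' a) (some (b, s))) := by
    intro s
    have h1 := congrFun h (some (b, s), ⟨G + i - a, by omega⟩)
    rw [hr _ _ a (by simp; omega), hr' _ _ a (by simp; omega)] at h1
    exact mul_right_cancel₀ hρ.ne' h1
  rw [← silu_sub_silu_neg (g a (r b)), ← silu_sub_silu_neg (g' a (r b))]
  exact congrArg₂ _ (hs true) (hs false)


/-! ### Assembly of the network -/

theorem Tokenizer.exists_joint_eq {J G P : ℕ} (τ : Tokenizer J G P) (j : Fin J) :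
    ∃ i p, τ.joint i p = j := by
  by_contra! h
  have h1 := τ.sum_weight j
  simp [h] at h1

theorem Tokenizer.abs_untokenize_sub_le {J G P D : ℕ} (τ : Tokenizer J G P)
    (y y' : Fin G → Fin P → Fin D → ℝ) (δ : ℝ) (h : ∀ i p d, |y i p d - y' i p d| ≤ δ)
    (j : Fin J) (d : Fin D) :
    |τ.untokenize y j d - τ.untokenize y' j d| ≤ (∑ i, ∑ p, |τ.weight i p|) * δ := by
  unfold Tokenizer.untokenize
  simp only [← Finset.sum_sub_distrib, Finset.sum_mul]
  refine (Finset.abs_sum_le_sum_abs _ _).trans (Finset.sum_le_sum fun i _ => ?_)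
  refine (Finset.abs_sum_le_sum_abs _ _).trans (Finset.sum_le_sum fun p _ => ?_)
  split_ifs
  · rw [← mul_sub, abs_mul]
    exact mul_le_mul_of_nonneg_left (h i p d) (abs_nonneg _)
  · rw [sub_zero, abs_zero]
    exact mul_nonneg (abs_nonneg _) ((abs_nonneg _).trans (h i p d))

/-- Every joint lies in a group, so for `0 < D` only the identity leaves the tokenizer unchanged:
equivariance is no restriction, and all continuous maps are approximated. -/
theorem exists_network_approx {J G P D : ℕ} (τ : Tokenizer J G P) (g : Pose J D → Pose J D)
    (hg : Continuous g) (K : Set (Pose J D)) (hK : IsCompact K) (ε : ℝ) (hε : 0 < ε) :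
    ∃ f : Network G P D, ∀ x ∈ K, ∀ j d, |f.toFun τ x j d - g x j d| < ε := by
  classical
  -- The features of a joint token form three blocks: the gathered pose, the slot within the group,
  -- and the coordinates of the joint itself.
  obtain ⟨N, ⟨e⟩⟩ := Finite.exists_equiv_fin (DelayChannel (Fin P × Fin D) G ⊕ Fin P ⊕ Fin D)
  let A : Matrix (Fin N) (Fin D) ℝ := Matrix.of fun f d => if f = e (.inr (.inr d)) then 1 else 0
  have hA : ∀ (v : Fin D → ℝ) (d : Fin D), A.mulVec v (e (.inr (.inr d))) = v d := by
    intro v d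
    simp [A, Matrix.mulVec, dotProduct]
  have hAt : ∀ (v : Fin N → ℝ) (d : Fin D), A.transpose.mulVec v d = v (e (.inr (.inr d))) := by
    intro v d
    simp [A, Matrix.mulVec, dotProduct]
  have hAc : ∀ j, Continuous fun x : Pose J D => A.mulVec (x j) := fun j =>
    Continuous.matrix_mulVec continuous_const (continuous_apply j)
  let r : Fin P × Fin D → Fin P × Fin N := fun a => (a.1, e (.inr (.inr a.2)))
  -- Every slot receives the full gathered feature; the bias `b` marks slot `p` by a unit vector.
  let W : Matrix (Fin P × Fin N) (DelayChannel (Fin P × Fin D) G) ℝ :=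
    Matrix.of fun q c => if q.2 = e (.inl c) then 1 else 0
  let b : Fin P × Fin N → ℝ := fun q => if q.2 = e (.inr (.inl q.1)) then 1 else 0
  let T : Pose J D → Fin G → Fin P × Fin N → ℝ := fun x => τ.tokenize fun j => A.mulVec (x j)
  have hTc : Continuous T := continuous_pi fun i => continuous_pi fun q =>
    (continuous_apply q.2).comp (hAc (τ.joint i q.1))
  let Φ : Fin G × Fin P × K → Fin N → ℝ := fun z f =>
    ∑ c, W (z.2.1, f) c * delayFeature r (T z.2.2) z.1 c + b (z.2.1, f)
  have hΦc : Continuous Φ := by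
    refine continuous_prod_of_discrete_left.mpr fun i =>
      continuous_prod_of_discrete_left.mpr fun p => continuous_pi fun f => ?_
    change Continuous fun x : K => ∑ c, W (p, f) c * delayFeature r (T x) i c + b (p, f)
    refine Continuous.add (continuous_finsetSum _ fun c _ =>
      Continuous.mul continuous_const ?_) continuous_const
    exact (continuous_delayFeature r i c).comp (hTc.comp continuous_subtype_val)
  have hΦ1 : ∀ z c, Φ z (e (.inl c)) = delayFeature r (T z.2.2) z.1 c := by
    intro z c
    simp [Φ, W, b]
  have hΦ2 : ∀ z p, Φ z (e (.inr (.inl p))) = if p = z.2.1 then 1 else 0 := by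
    intro z p
    simp [Φ, W, b]
  have hΦi : Function.Injective Φ := by
    rintro ⟨i, p, x⟩ ⟨i', p', x'⟩ h
    obtain ⟨hi, hx⟩ := delayFeature_injective r (g := T x) (g' := T x') (i := i) (i' := i')
      (funext fun c => by
        have := congrFun h (e (.inl c))
        rwa [hΦ1, hΦ1] at this)
    have hp : p = p' := by
      have := congrFun h (e (.inr (.inl p)))
      rw [hΦ2, hΦ2, if_pos rfl] at this
      by_contra hne
      rw [if_neg hne] at this
      exact one_ne_zero this
    have hxx : x = x' := by
      refine Subtype.ext (funext fun j => funext fun d => ?_)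
      obtain ⟨a, q, rfl⟩ := τ.exists_joint_eq j
      have := hx a (q, d)
      simpa only [T, r, Tokenizer.tokenize, hA] using this
    rw [hi, hp, hxx]
  have : CompactSpace K := isCompact_iff_compactSpace.mp hK
  have htgt : Continuous fun z : Fin G × Fin P × K =>
      A.mulVec (g z.2.2.1 (τ.joint z.1 z.2.1)) := by
    refine continuous_prod_of_discrete_left.mpr fun i =>
      continuous_prod_of_discrete_left.mpr fun p => ?_
    exact (hAc (τ.joint i p)).comp (hg.comp continuous_subtype_val)
  -- Tietze extension from the compact image of `Φ`. All copies of a joint get the same target, so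
  -- the inverse tokenizer returns it exactly.
  obtain ⟨F, hF⟩ := ContinuousMap.exists_extension' (hΦc.isClosedEmbedding hΦi) ⟨_, htgt⟩
  set Q : ℝ := ∑ i, ∑ p, |τ.weight i p| with hQ
  have hQ0 : 0 ≤ Q := Finset.sum_nonneg fun _ _ => Finset.sum_nonneg fun _ _ => abs_nonneg _
  -- The bound `1` keeps the merged features in the ball of radius `R + 1` on which the temporal
  -- scan is close to the identity; the other `ε / 2` is left for that scan.
  set η : ℝ := min 1 (ε / 2) with hη
  have hη0 : 0 < η := lt_min one_pos (by positivity)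
  obtain ⟨mG, hmG⟩ := exists_groupScan_eq G r W
  obtain ⟨mJ, hmJ⟩ := SSD.exists_approx (Set.range Φ) (isCompact_range hΦc) F F.continuous
    -- Merging multiplies errors by at most `Q`; adding one avoids division by zero.
    (η / (Q + 1)) (by positivity)
  obtain ⟨R, hR⟩ := hK.exists_bound_of_continuousOn (f := fun x j => A.mulVec (g x j))
    (continuous_pi fun j => (hAc j).comp hg).continuousOn
  obtain ⟨mF, hmF⟩ := SSD.exists_approx (Metric.closedBall (0 : Fin N → ℝ) (R + 1))
    (isCompact_closedBall _ _) id continuous_id (ε / 2) (by positivity)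
  obtain ⟨mB, hmB⟩ := SSD.exists_apply_eq_zero (Fin N)
  refine ⟨⟨N, A, 0, ⟨2, two_pos, fun _ => 1, mG, 1, b, mJ, mF, mB⟩, A.transpose, 0⟩,
    fun x hx j d => ?_⟩
  set y : Fin G → Fin P → Fin N → ℝ :=
    jointScan 1 b mJ (groupScan mG (fun _ : Fin 2 => 1) (T x)) with hy
  have hnet : Network.toFun ⟨N, A, 0, ⟨2, two_pos, fun _ => 1, mG, 1, b, mJ, mF, mB⟩,
      A.transpose, 0⟩ τ x j d =
      mF.apply (fun _ : Fin 1 => τ.untokenize y j) 0 (e (.inr (.inr d))) := by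
    simp only [Network.toFun, Block.apply, add_zero]
    rw [hAt]
    unfold temporalScan
    rw [hmB, add_zero]
  have hyt : ∀ i p f, |y i p f - A.mulVec (g x (τ.joint i p)) f| ≤ η / (Q + 1) := by
    intro i p f
    have hu : ∀ p : Fin P, (fun d => ((1 : Matrix (Fin P × Fin N) (Fin P × Fin N) ℝ).mulVec
        (groupScan mG (fun _ : Fin 2 => 1) (T x) i) + b) (p, d)) = Φ (i, p, ⟨x, hx⟩) := by
      intro p
      funext f
      rw [Matrix.one_mulVec, Pi.add_apply, hmG]
    have h1 := hmJ (fun p d => ((1 : Matrix (Fin P × Fin N) (Fin P × Fin N) ℝ).mulVec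
        (groupScan mG (fun _ : Fin 2 => 1) (T x) i) + b) (p, d)) p ⟨_, (hu p).symm⟩ f
    rw [hu p, show F (Φ (i, p, ⟨x, hx⟩)) = _ from congrFun hF _] at h1
    exact h1.le
  have hut : ∀ f, |τ.untokenize y j f - A.mulVec (g x j) f| ≤ η := by
    intro f
    have h1 := τ.abs_untokenize_sub_le y (fun i p => A.mulVec (g x (τ.joint i p))) _ hyt j f
    have h2 := congrFun (congrFun (τ.untokenize_tokenize fun j => A.mulVec (g x j)) j) f
    rw [show τ.untokenize (fun i p => A.mulVec (g x (τ.joint i p))) j f = A.mulVec (g x j) f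
      from h2] at h1
    refine h1.trans ?_
    rw [← hQ, ← mul_div_assoc, div_le_iff₀ (by positivity)]
    nlinarith
  have hball : τ.untokenize y j ∈ Metric.closedBall (0 : Fin N → ℝ) (R + 1) := by
    have hR0 : 0 ≤ R := (norm_nonneg _).trans (hR x hx)
    rw [mem_closedBall_zero_iff, pi_norm_le_iff_of_nonneg (by positivity)]
    intro f
    have h1 : |A.mulVec (g x j) f| ≤ R :=
      ((norm_le_pi_norm (A.mulVec (g x j)) f).trans
        (norm_le_pi_norm (fun j => A.mulVec (g x j)) j)).trans (hR x hx)
    have h2 := hut f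
    have h3 : η ≤ 1 := min_le_left _ _
    rw [Real.norm_eq_abs]
    rw [abs_le] at *
    constructor <;> linarith
  have h1 := hmF (fun _ : Fin 1 => τ.untokenize y j) 0 hball (e (.inr (.inr d)))
  have h2 := hut (e (.inr (.inr d)))
  rw [hA] at h2
  have h3 : η ≤ ε / 2 := min_le_right _ _
  rw [hnet]
  rw [id_eq] at h1
  rw [abs_le] at h2
  rw [abs_lt] at *
  constructor <;> linarith

end SkeletonMamba

theorem theorem1 {J G P D : ℕ} (τ : SkeletonMamba.Tokenizer J G P)
    (g : SkeletonMamba.Pose J D → SkeletonMamba.Pose J D) (hg : Continuous g)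
    (hH : SkeletonMamba.Equivariant (τ.symmetries D) g)
    (K : Set (SkeletonMamba.Pose J D)) (hK : IsCompact K) (ε : ℝ) (hε : 0 < ε) :
    ∃ f : SkeletonMamba.Network G P D, ∀ x ∈ K, ‖f.toFun τ x - g x‖ < ε := by
  obtain ⟨f, hf⟩ := SkeletonMamba.exists_network_approx τ g hg K hK ε hε
  refine ⟨f, fun x hx => ?_⟩
  rw [pi_norm_lt_iff hε]
  intro j
  rw [pi_norm_lt_iff hε]
  exact hf x hx j
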